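/- For a graph $H$, let $\mathscr{C}(H)$ be the set of connected (finite) graphs containing $H$ as a (not necessarily induced) subgraph, and for a set $\mathscr{G}$ of graphs let $R_2(\mathscr{G})$ be the minimum integer $n$ such that every coloring of the edges of the complete graph $K_n$ with at most two colors contains a monochromatic copy of some graph in $\mathscr{G}$. Let $mC_5$ denote the disjoint union of $m$ cycles of length $5$. Then for every integer $m\geq 2$, $$R_2(\mathscr{C}(mC_5)) = 11m-2.$$ That is, every red/blue coloring of the edges of $K_{11m-2}$ contains a monochromatic connected subgraph containing $m$ vertex-disjoint $5$-cycles, while for every $n<11m-2$ some red/blue coloring of the edges of $K_n$ contains no such subgraph. -/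

import Mathlib

/-- `copies m H` is `mH`, the disjoint union of `m` copies of the graph `H`. -/
def copies (m : ℕ) {V : Type*} (H : SimpleGraph V) : SimpleGraph (Fin m × V) where
  Adj x y := x.1 = y.1 ∧ H.Adj x.2 y.2
  symm := ⟨fun _ _ h => ⟨h.1.symm, h.2.symm⟩⟩
  loopless := ⟨fun x h => H.loopless.irrefl x.2 h.2⟩

/-- A family (set) of finite graphs, each graph being given on a vertex set `Fin k`. -/
abbrev GraphFamily : Type := Set (Σ k : ℕ, SimpleGraph (Fin k))

/-- `𝒞(H)`: the set of connected (finite) graphs containing `H` as a (not necessarily induced)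
subgraph. -/
def connectedContaining {V : Type*} (H : SimpleGraph V) : GraphFamily :=
  {G | G.2.Connected ∧ H.IsContained G.2}

/-- Every colouring of the edges of the complete graph `K_n` with (at most) two colours contains
a monochromatic copy of some graph of the family `𝒢`: for some colour, the graph formed by the
edges of that colour contains a copy of a member of `𝒢`. -/
def TwoColorArrows (n : ℕ) (𝒢 : GraphFamily) : Prop :=
  ∀ c : SimpleGraph.TopEdgeLabeling (Fin n) (Fin 2),
    ∃ i : Fin 2, ∃ G ∈ 𝒢, G.2.IsContained (c.labelGraph i)

/-- `R` is the 2-colour Ramsey number `R₂(𝒢)`: the minimum number `n` such that every 2-colouring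
of `K_n` contains a monochromatic copy of some graph in `𝒢`. -/
def IsTwoColorRamseyNumber (𝒢 : GraphFamily) (R : ℕ) : Prop :=
  IsLeast {n : ℕ | TwoColorArrows n 𝒢} R

/-! Lower bound: take two disjoint cliques of order 5m-1 in one colour and give every other edge the
second colour. A component of the clique colour has fewer than 5m vertices. The second colour is
bipartite away from the at most m-1 leftover vertices, so each of its 5-cycles uses one of them.

Upper bound: any 10 vertices contain a monochromatic 5-cycle, so greedy removal from 10m vertices
gives m disjoint ones of a single colour. As m ≥ 2 gives 10m ≤ 11m-2, this settles the case where
both colours are connected. Otherwise, say red is disconnected: the vertices split into A and Z with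
only blue edges across, so blue is connected, and blue edges or paths inside one side close up to
blue 5-cycles through the other (`packs_isPent_of_two_matchings`, `packs_isPent_of_paths_cross`).
Conversely, a side whose blue matching number a is at most m is nearly a red clique, and 5m+a
vertices there suffice for m red 5-cycles in one component (`packs_isPent_of_matching`).

If both sides have at least 3m vertices, these two facts suffice
(`hasConnectedPents_of_large_sides`), and the bound 11m-2 is used exactly. If Z is smaller, A can be
chosen red-connected, and `packs_isPent_of_small_side` finishes by cases on |Z|. -/

/-- `Packs P m S`: the finite set `S` contains `m` pairwise disjoint sets satisfying `P`. -/
inductive Packs {V : Type*} [DecidableEq V] (P : Finset V → Prop) : ℕ → Finset V → Prop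
  | zero (S : Finset V) : Packs P 0 S
  | succ {m : ℕ} {S t : Finset V} (ht : P t) (hS : t ⊆ S) (h : Packs P m (S \ t)) :
      Packs P (m + 1) S

/-- `t` is the vertex set of a `5`-cycle of `G`. -/
def IsPent {V : Type*} [DecidableEq V] (G : SimpleGraph V) (t : Finset V) : Prop :=
  ∃ a b c d e : V, t = {a, b, c, d, e} ∧ G.Adj a b ∧ G.Adj b c ∧ G.Adj c d ∧ G.Adj d e ∧
    G.Adj e a ∧ a ≠ c ∧ a ≠ d ∧ b ≠ d ∧ b ≠ e ∧ c ≠ e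

/-- `t` is the vertex set of a path with four vertices in `G`. -/
def IsPathFour {V : Type*} [DecidableEq V] (G : SimpleGraph V) (t : Finset V) : Prop :=
  ∃ a b c d : V, t = {a, b, c, d} ∧ G.Adj a b ∧ G.Adj b c ∧ G.Adj c d ∧ a ≠ c ∧ a ≠ d ∧ b ≠ d

/-- `t` is the vertex set of an edge of `G`. -/
def IsEdgeSet {V : Type*} [DecidableEq V] (G : SimpleGraph V) (t : Finset V) : Prop :=
  ∃ a b : V, t = {a, b} ∧ G.Adj a b

/-! ### Disjoint packings and greedy removal -/

section Packing

variable {V : Type*} [DecidableEq V] {P Q : Finset V → Prop} {S T : Finset V} {m k : ℕ}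

theorem Packs.mono (h : Packs P m S) (hST : S ⊆ T) : Packs P m T := by
  induction h generalizing T with
  | zero => exact .zero _
  | succ ht hS _ ih => exact .succ ht (hS.trans hST) (ih (Finset.sdiff_subset_sdiff hST le_rfl))

theorem Packs.of_le (h : Packs P m S) (hk : k ≤ m) : Packs P k S := by
  induction h generalizing k with
  | zero => obtain rfl : k = 0 := by omega
            exact .zero _
  | succ ht hS _ ih =>
    cases k with
    | zero => exact .zero _
    | succ k => exact .succ ht hS (ih (by omega))

theorem Packs.one {t : Finset V} (ht : P t) (hS : t ⊆ S) : Packs P 1 S :=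
  .succ ht hS (.zero _)

theorem Packs.add (h : Packs P m S) (h' : Packs P k T) (hd : Disjoint S T) :
    Packs P (m + k) (S ∪ T) := by
  induction h with
  | zero => simpa using h'.mono Finset.subset_union_right
  | @succ m S t ht hS _ ih =>
    rw [Nat.add_right_comm]
    refine .succ ht (hS.trans Finset.subset_union_left)
      ((ih (hd.mono_left Finset.sdiff_subset)).mono ?_)
    intro x hx
    have hxd : x ∈ T → x ∉ _ := fun h => Finset.disjoint_right.1 hd h
    grind

/-- The union of the packed sets is again packed. -/
theorem Packs.exists_support {p : ℕ} (hP : ∀ t, P t → t.card = p) (h : Packs P m S) :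
    ∃ M ⊆ S, M.card = p * m ∧ Packs P m M := by
  induction h with
  | zero S => exact ⟨∅, by simp, by simp, .zero _⟩
  | @succ m S t ht hS _ ih =>
    obtain ⟨M, hM, hc, hp⟩ := ih
    have hd : Disjoint t M := Finset.disjoint_right.2 fun x hx => (Finset.mem_sdiff.1 (hM hx)).2
    refine ⟨t ∪ M, Finset.union_subset hS (hM.trans Finset.sdiff_subset), ?_, ?_⟩
    · rw [Finset.card_union_of_disjoint hd, hP t ht, hc]; ring
    · rw [Nat.add_comm]
      exact (Packs.one ht le_rfl).add hp hd

/-- Enlarging each packed set by `r` vertices of a disjoint reservoir. -/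
theorem Packs.extend {X M : Finset V} {r : ℕ} (h : Packs P m M) (hd : Disjoint M X)
    (hX : r * m ≤ X.card)
    (hPQ : ∀ t x, P t → t ⊆ M → x ⊆ X → x.card = r → Q (t ∪ x)) : Packs Q m (M ∪ X) := by
  induction h generalizing X with
  | zero => exact .zero _
  | @succ m M t ht hM _ ih =>
    obtain ⟨x, hxX, hx⟩ := Finset.exists_subset_card_eq (s := X) (n := r) (by nlinarith)
    have key := @ih (X \ x) (hd.mono Finset.sdiff_subset Finset.sdiff_subset)
      (by rw [Finset.card_sdiff_of_subset hxX, hx]; rw [Nat.mul_add] at hX; omega)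
      (fun t' x' h1 h2 h3 h4 => hPQ t' x' h1 (h2.trans Finset.sdiff_subset)
        (h3.trans Finset.sdiff_subset) h4)
    refine .succ (hPQ t x ht hM hxX hx) (Finset.union_subset_union hM hxX) (key.mono ?_)
    intro y hy
    have hyd : y ∈ X → y ∉ M := fun h => Finset.disjoint_right.1 hd h
    have h1 := @hM y
    have h2 := @hxX y
    grind

/-- Greedy packing: if every set with `n` vertices contains a set satisfying `P` or one
satisfying `Q`, then large sets contain many disjoint ones of one kind. -/
theorem packs_or_packs {n p q : ℕ} (hP : ∀ t, P t → t.card = p) (hQ : ∀ t, Q t → t.card = q)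
    (hS : ∀ T ⊆ S, n ≤ T.card → (∃ t ⊆ T, P t) ∨ ∃ t ⊆ T, Q t) :
    ∀ a b : ℕ, p * a + q * b + n ≤ S.card → Packs P (a + 1) S ∨ Packs Q (b + 1) S := by
  intro a b
  induction hs : a + b generalizing a b S with
  | zero =>
    intro h
    obtain ⟨rfl, rfl⟩ : a = 0 ∧ b = 0 := by omega
    rcases hS S le_rfl (by omega) with ⟨t, h1, h2⟩ | ⟨t, h1, h2⟩
    · exact .inl (.one h2 h1)
    · exact .inr (.one h2 h1)
  -- Removing the set found lowers its counter by one and the required size by exactly the number of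
  -- vertices removed.
  | succ s ih =>
    intro h
    rcases hS S le_rfl (by omega) with ⟨t, h1, h2⟩ | ⟨t, h1, h2⟩
    · cases a with
      | zero => exact .inl (.one h2 h1)
      | succ a =>
        rcases @ih (S \ t) (fun T hT => hS T (hT.trans Finset.sdiff_subset)) a b (by omega)
          (by rw [Finset.card_sdiff_of_subset h1, hP t h2]; rw [Nat.mul_add] at h; omega)
          with h3 | h3
        · exact .inl (.succ h2 h1 h3)
        · exact .inr (h3.mono Finset.sdiff_subset)
    · cases b with
      | zero => exact .inr (.one h2 h1)
      | succ b =>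
        rcases @ih (S \ t) (fun T hT => hS T (hT.trans Finset.sdiff_subset)) a b (by omega)
          (by rw [Finset.card_sdiff_of_subset h1, hQ t h2]; rw [Nat.mul_add] at h; omega)
          with h3 | h3
        · exact .inl (h3.mono Finset.sdiff_subset)
        · exact .inr (.succ h2 h1 h3)

theorem IsPent.card {G : SimpleGraph V} {t : Finset V} (h : IsPent G t) : t.card = 5 := by
  obtain ⟨a, b, c, d, e, rfl, h1, h2, h3, h4, h5, h6⟩ := h
  have := h1.ne; have := h2.ne; have := h3.ne; have := h4.ne; have := h5.ne
  grind

theorem IsPathFour.card {G : SimpleGraph V} {t : Finset V} (h : IsPathFour G t) :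
    t.card = 4 := by
  obtain ⟨a, b, c, d, rfl, h1, h2, h3, h4, h5, h6⟩ := h
  have := h1.ne; have := h2.ne; have := h3.ne
  grind

theorem IsEdgeSet.card {G : SimpleGraph V} {t : Finset V} (h : IsEdgeSet G t) :
    t.card = 2 := by
  obtain ⟨a, b, rfl, h⟩ := h
  exact Finset.card_pair h.ne

end Packing

/-! ### Monochromatic 5-cycles on ten vertices -/

section SmallRamsey

variable {V : Type*} [DecidableEq V] {R B : SimpleGraph V} {S : Finset V}

/-- The vertices of a `5`-cycle lying in `S`. -/
theorem exists_isPent {G : SimpleGraph V} {a b c d e : V} (ha : a ∈ S) (hb : b ∈ S) (hc : c ∈ S)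
    (hd : d ∈ S) (he : e ∈ S) (h1 : G.Adj a b) (h2 : G.Adj b c) (h3 : G.Adj c d) (h4 : G.Adj d e)
    (h5 : G.Adj e a) (h6 : a ≠ c) (h7 : a ≠ d) (h8 : b ≠ d) (h9 : b ≠ e) (h10 : c ≠ e) :
    ∃ t ⊆ S, IsPent G t :=
  ⟨{a, b, c, d, e}, by grind, a, b, c, d, e, rfl, h1, h2, h3, h4, h5, h6, h7, h8, h9, h10⟩

/-- The vertices of a path with four vertices lying in `S`. -/
theorem exists_isPathFour {G : SimpleGraph V} {a b c d : V} (ha : a ∈ S) (hb : b ∈ S)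
    (hc : c ∈ S) (hd : d ∈ S) (h1 : G.Adj a b) (h2 : G.Adj b c) (h3 : G.Adj c d)
    (h6 : a ≠ c) (h7 : a ≠ d) (h8 : b ≠ d) :
    ∃ t ⊆ S, IsPathFour G t :=
  ⟨{a, b, c, d}, by grind, a, b, c, d, rfl, h1, h2, h3, h6, h7, h8⟩

theorem exists_isPent_of_isClique {G : SimpleGraph V} {W : Finset V} (hW : G.IsClique W)
    (h : 5 ≤ W.card) : ∃ t ⊆ W, IsPent G t := by
  obtain ⟨W', hW', h₀⟩ := Finset.exists_subset_card_eq h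
  obtain ⟨a, W₁, ha, rfl, h₁⟩ := Finset.card_eq_succ.1 h₀
  obtain ⟨b, W₂, hb, rfl, h₂⟩ := Finset.card_eq_succ.1 h₁
  obtain ⟨c, W₃, hc', rfl, h₃⟩ := Finset.card_eq_succ.1 h₂
  obtain ⟨d, e, hde, rfl⟩ := Finset.card_eq_two.1 h₃
  simp only [Finset.insert_subset_iff, Finset.singleton_subset_iff] at hW'
  obtain ⟨h1, h2, h3, h4, h5⟩ := hW'
  simp only [Finset.mem_insert, Finset.mem_singleton, not_or] at ha hb hc'
  exact exists_isPent h1 h2 h3 h4 h5 (hW h1 h2 ha.1) (hW h2 h3 hb.1) (hW h3 h4 hc'.1)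
    (hW h4 h5 hde) (hW h5 h1 (Ne.symm ha.2.2.2)) ha.2.1 ha.2.2.1 hb.2.1 hb.2.2 hc'.2

/-- A red `K₄` together with five further vertices contains a monochromatic `5`-cycle. -/
theorem exists_isPent_of_isNClique_four (hRB : ∀ x y, x ≠ y → R.Adj x y ∨ B.Adj x y)
    {Q : Finset V} (hQS : Q ⊆ S) (hQ : R.IsNClique 4 Q) (hS : 9 ≤ S.card) :
    (∃ t ⊆ S, IsPent R t) ∨ ∃ t ⊆ S, IsPent B t := by
  classical
  by_contra! hcon
  obtain ⟨hR, hB⟩ := hcon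
  have hQ4 := hQ.card_eq
  have hcl := hQ.isClique
  have hW : 5 ≤ (S \ Q).card := by rw [Finset.card_sdiff_of_subset hQS]; omega
  -- Two red neighbours p, q of w in Q, with the other two vertices r, s of Q, give the red 5-cycle
  -- w p r s q.
  have hred : ∀ w ∈ S \ Q, (Q.filter (R.Adj w)).card ≤ 1 := by
    intro w hw
    by_contra! h
    obtain ⟨p, hp, q, hq, hpq⟩ := Finset.one_lt_card.1 h
    rw [Finset.mem_filter] at hp hq
    have h2 : 1 < (Q \ {p, q}).card := by
      have := Finset.le_card_sdiff {p, q} Q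
      rw [Finset.card_pair hpq] at this
      omega
    obtain ⟨r, hr, s, hs, hrs⟩ := Finset.one_lt_card.1 h2
    simp only [Finset.mem_sdiff, Finset.mem_insert, Finset.mem_singleton, not_or] at hr hs hw
    obtain ⟨t, ht, ht'⟩ := exists_isPent hw.1 (hQS hp.1) (hQS hr.1) (hQS hs.1) (hQS hq.1) hp.2
      (hcl hp.1 hr.1 (Ne.symm hr.2.1)) (hcl hr.1 hs.1 hrs) (hcl hs.1 hq.1 hs.2.2) hq.2.symm
      (by grind) (by grind) (by grind) hpq (by grind)
    exact hR t ht ht'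
  -- A blue edge w w' outside Q extends to a blue 5-cycle w w' p u q with p, q in Q. Each outer
  -- vertex has at most one red neighbour in Q, so at most two vertices are forbidden for p, and at
  -- most three, counting p itself, for q.
  have hclW : R.IsClique ((S \ Q : Finset V) : Set V) := by
    intro w hw w' hw' hne
    by_contra hww
    have hb := (hRB w w' hne).resolve_left hww
    obtain ⟨u, hu⟩ : ((S \ Q) \ {w, w'}).Nonempty := by
      rw [← Finset.card_pos]
      have := Finset.le_card_sdiff {w, w'} (S \ Q)
      rw [Finset.card_pair hne] at this
      omega
    rw [Finset.mem_coe] at hw hw'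
    have hu' : u ∈ S \ Q := (Finset.mem_sdiff.1 hu).1
    obtain ⟨p, hp⟩ : (Q \ (Q.filter (R.Adj w') ∪ Q.filter (R.Adj u))).Nonempty := by
      rw [← Finset.card_pos]
      have h1 := Finset.le_card_sdiff (Q.filter (R.Adj w') ∪ Q.filter (R.Adj u)) Q
      have h2 := Finset.card_union_le (Q.filter (R.Adj w')) (Q.filter (R.Adj u))
      have := hred w' hw'
      have := hred u hu'
      omega
    obtain ⟨q, hq⟩ :
        (Q \ ((Q.filter (R.Adj u) ∪ Q.filter (R.Adj w)) ∪ {p})).Nonempty := by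
      rw [← Finset.card_pos]
      have h1 := Finset.le_card_sdiff ((Q.filter (R.Adj u) ∪ Q.filter (R.Adj w)) ∪ {p}) Q
      have h2 := Finset.card_union_le (Q.filter (R.Adj u)) (Q.filter (R.Adj w))
      have h3 := Finset.card_union_le (Q.filter (R.Adj u) ∪ Q.filter (R.Adj w)) {p}
      rw [Finset.card_singleton] at h3
      have := hred w hw
      have := hred u hu'
      omega
    simp only [Finset.mem_sdiff, Finset.mem_union, Finset.mem_filter, Finset.mem_insert,
      Finset.mem_singleton, not_or, not_and] at hp hq hu hw hw' hu'
    have hne' : ∀ {x y}, x ∈ Q → y ∉ Q → x ≠ y := fun h h' e => h' (e ▸ h)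
    obtain ⟨t, ht, ht'⟩ := exists_isPent (G := B) hw.1 hw'.1 (hQS hp.1) hu'.1 (hQS hq.1) hb
      ((hRB w' p (hne' hp.1 hw'.2).symm).resolve_left (hp.2.1 hp.1))
      ((hRB u p (hne' hp.1 hu'.2).symm).resolve_left (hp.2.2 hp.1)).symm
      ((hRB u q (hne' hq.1 hu'.2).symm).resolve_left (hq.2.1.1 hq.1))
      ((hRB w q (hne' hq.1 hw.2).symm).resolve_left (hq.2.1.2 hq.1)).symm
      (by grind) (by grind) (by grind) (by grind) (by grind)
    exact hB t ht ht'
  obtain ⟨t, ht, ht'⟩ := exists_isPent_of_isClique hclW hW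
  exact hR t (ht.trans Finset.sdiff_subset) ht'

/-- Five vertices without a red path on four vertices and without a blue `5`-cycle span a red
triangle or a blue `K₄`. -/
theorem exists_triangle_or_four_clique (hRB : ∀ x y, x ≠ y → R.Adj x y ∨ B.Adj x y)
    {N : Finset V} (hN : 5 ≤ N.card) (hR : ∀ t ⊆ N, ¬ IsPathFour R t)
    (hB : ∀ t ⊆ N, ¬ IsPent B t) :
    (∃ T ⊆ N, R.IsNClique 3 T) ∨ ∃ Q ⊆ N, B.IsNClique 4 Q := by
  classical
  by_contra! hcon
  obtain ⟨hT, hQ⟩ := hcon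
  have hT' : ∀ a ∈ N, ∀ b ∈ N, ∀ c ∈ N, R.Adj a b → R.Adj a c → ¬ R.Adj b c :=
    fun a ha b hb c hc h1 h2 h3 => hT {a, b, c} (by grind)
      (SimpleGraph.is3Clique_triple_iff.2 ⟨h1, h2, h3⟩)
  have hQ' : ∀ a ∈ N, ∀ b ∈ N, ∀ c ∈ N, ∀ d ∈ N, B.Adj a b → B.Adj a c → B.Adj a d →
      B.Adj b c → B.Adj b d → ¬ B.Adj c d := by
    intro a ha b hb c hc d hd h1 h2 h3 h4 h5 h6
    refine hQ {a, b, c, d} (by grind) ?_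
    have h := (SimpleGraph.is3Clique_triple_iff (G := B)).2 ⟨h4, h5, h6⟩
    exact h.insert (by simp [h1, h2, h3])
  have hP' : ∀ a ∈ N, ∀ b ∈ N, ∀ c ∈ N, ∀ d ∈ N, R.Adj a b → R.Adj b c → a ≠ c → a ≠ d → b ≠ d →
      ¬ R.Adj c d := by
    intro a ha b hb c hc d hd h1 h2 h3 h4 h5 h6
    obtain ⟨t, ht, ht'⟩ := exists_isPathFour ha hb hc hd h1 h2 h6 h3 h4 h5
    exact hR t ht ht'
  have blue : ∀ {x y}, x ≠ y → ¬ R.Adj x y → B.Adj x y := fun h h' => (hRB _ _ h).resolve_left h'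
  have fifth : ∀ a b c d : V, ∃ e ∈ N, e ≠ a ∧ e ≠ b ∧ e ≠ c ∧ e ≠ d := by
    intro a b c d
    obtain ⟨e, he⟩ : (N \ {a, b, c, d}).Nonempty := by
      rw [← Finset.card_pos]
      have h1 := Finset.le_card_sdiff {a, b, c, d} N
      have h2 := Finset.card_le_four (a := a) (b := b) (c := c) (d := d)
      omega
    exact ⟨e, by grind⟩
  -- Red degree at least three: the leaves a, b, c are pairwise blue, for want of a red triangle,
  -- and blue to the fifth vertex, for want of a red four-vertex path. Together these four form a
  -- blue clique.
  by_cases h3 : ∃ x ∈ N, ∃ a ∈ N, ∃ b ∈ N, ∃ c ∈ N, a ≠ b ∧ a ≠ c ∧ b ≠ c ∧ R.Adj x a ∧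
      R.Adj x b ∧ R.Adj x c
  · obtain ⟨x, hx, a, ha, b, hb, c, hc, hab, hac, hbc, h1, h2, h3⟩ := h3
    obtain ⟨e, he, hex, hea, heb, hec⟩ := fifth x a b c
    refine hQ' a ha b hb c hc e he (blue hab (hT' x hx a ha b hb h1 h2))
      (blue hac (hT' x hx a ha c hc h1 h3)) (blue hea.symm ?_)
      (blue hbc (hT' x hx b hb c hc h2 h3)) (blue heb.symm ?_) (blue hec.symm ?_)
    · exact hP' b hb x hx a ha e he h2.symm h1 hab.symm heb.symm hex.symm
    · exact hP' a ha x hx b hb e he h1.symm h2 hab hea.symm hex.symm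
    · exact hP' a ha x hx c hc e he h1.symm h3 hac hea.symm hex.symm
  -- Red degree exactly two at x: with the remaining vertices d, e, the cycle x d a b e is blue.
  by_cases h2 : ∃ x ∈ N, ∃ a ∈ N, ∃ b ∈ N, a ≠ b ∧ R.Adj x a ∧ R.Adj x b
  · obtain ⟨x, hx, a, ha, b, hb, hab, h1, h2⟩ := h2
    obtain ⟨d, hd, hdx, hda, hdb, -⟩ := fifth x a b b
    obtain ⟨e, he, hex, hea, heb, hed⟩ := fifth x a b d
    have hxd : ¬ R.Adj x d := fun h =>
      h3 ⟨x, hx, a, ha, b, hb, d, hd, hab, hda.symm, hdb.symm, h1, h2, h⟩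
    have hxe : ¬ R.Adj x e := fun h =>
      h3 ⟨x, hx, a, ha, b, hb, e, he, hab, hea.symm, heb.symm, h1, h2, h⟩
    obtain ⟨t, ht, ht'⟩ := exists_isPent (G := B) hx hd ha hb he (blue hdx.symm hxd)
      (blue hda.symm (hP' b hb x hx a ha d hd h2.symm h1 hab.symm hdb.symm hdx.symm)).symm
      (blue hab (hT' x hx a ha b hb h1 h2))
      (blue heb.symm (hP' a ha x hx b hb e he h1.symm h2 hab hea.symm hex.symm))
      (blue hex.symm hxe).symm h1.ne h2.ne hdb hed.symm hea.symm
    exact hB t ht ht'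
  have one : ∀ x ∈ N, ∀ a ∈ N, ∀ b ∈ N, x ≠ b → a ≠ b → R.Adj x a → B.Adj x b :=
    fun x hx a ha b hb hxb hab h => blue hxb fun h' => h2 ⟨x, hx, a, ha, b, hb, hab, h, h'⟩
  by_cases h1 : ∃ x ∈ N, ∃ y ∈ N, R.Adj x y
  · obtain ⟨x, hx, y, hy, hxy⟩ := h1
    -- The red edges now form a matching, so x and y are blue to all other vertices; a blue edge c d
    -- among the other three closes the blue cycle x c d y e. Three vertices cannot be pairwise
    -- joined by edges of a matching, so such an edge exists.
    have pent : ∀ c ∈ N, ∀ d ∈ N, ∀ e ∈ N, c ≠ x → c ≠ y → d ≠ x → d ≠ y → e ≠ x → e ≠ y →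
        c ≠ e → d ≠ e → ¬ B.Adj c d := by
      intro c hc d hd e he hcx hcy hdx hdy hex hey hce hde h
      obtain ⟨t, ht, ht'⟩ := exists_isPent (G := B) hx hc hd hy he
        (one x hx y hy c hc hcx.symm hcy.symm hxy) h
        (one y hy x hx d hd hdy.symm hdx.symm hxy.symm).symm
        (one y hy x hx e he hey.symm hex.symm hxy.symm)
        (one x hx y hy e he hex.symm hey.symm hxy).symm hdx.symm hxy.ne hcy hce hde
      exact hB t ht ht'
    obtain ⟨c, hc, hcx, hcy, -, -⟩ := fifth x y y y
    obtain ⟨d, hd, hdx, hdy, hdc, -⟩ := fifth x y c c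
    obtain ⟨e, he, hex, hey, hec, hed⟩ := fifth x y c d
    by_cases hcd : R.Adj c d
    · exact pent c hc e he d hd hcx hcy hex hey hdx hdy hdc.symm hed
        (one c hc d hd e he hec.symm hed.symm hcd)
    · exact pent c hc d hd e he hcx hcy hdx hdy hex hey hec.symm hed.symm (blue hdc.symm hcd)
  · push Not at h1
    obtain ⟨Q, hQN, hQ4⟩ := Finset.exists_subset_card_eq (s := N) (n := 4) (by omega)
    exact hQ Q hQN ⟨fun x hx y hy hxy => blue hxy (h1 x (hQN hx) y (hQN hy)), hQ4⟩

/-- A red four-vertex path among the red neighbours of v closes through v to a red 5-cycle, so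
`exists_triangle_or_four_clique` applies to the neighbourhood. A red triangle found there becomes a
red clique of order four on adding v. -/
theorem exists_isNClique_four_of_degree (hRB : ∀ x y, x ≠ y → R.Adj x y ∨ B.Adj x y)
    {v : V} (hv : v ∈ S) {N : Finset V} (hNS : N ⊆ S) (hvN : ∀ x ∈ N, R.Adj v x)
    (hN : 5 ≤ N.card) (hR : ∀ t ⊆ S, ¬ IsPent R t) (hB : ∀ t ⊆ S, ¬ IsPent B t) :
    (∃ Q ⊆ S, R.IsNClique 4 Q) ∨ ∃ Q ⊆ S, B.IsNClique 4 Q := by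
  have hP : ∀ t ⊆ N, ¬ IsPathFour R t := by
    rintro t ht ⟨a, b, c, d, rfl, h1, h2, h3, h4, h5, h6⟩
    simp only [Finset.insert_subset_iff, Finset.singleton_subset_iff] at ht
    obtain ⟨ha, hb, hc, hd⟩ := ht
    obtain ⟨t, ht, ht'⟩ := exists_isPent hv (hNS ha) (hNS hb) (hNS hc) (hNS hd) (hvN a ha) h1 h2
      h3 (hvN d hd).symm (hvN b hb).ne (hvN c hc).ne h4 h5 h6
    exact hR t ht ht'
  rcases exists_triangle_or_four_clique hRB hN hP (fun t ht => hB t (ht.trans hNS)) with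
    ⟨T, hTN, hT⟩ | ⟨Q, hQN, hQ⟩
  · exact .inl ⟨insert v T, Finset.insert_subset hv (hTN.trans hNS),
      hT.insert fun x hx => hvN x (hTN hx)⟩
  · exact .inr ⟨Q, hQN.trans hNS, hQ⟩

/-- Every two-colouring of `K₁₀` contains a monochromatic `5`-cycle. -/
theorem exists_isPent_or_isPent (hRB : ∀ x y, x ≠ y → R.Adj x y ∨ B.Adj x y)
    (hS : 10 ≤ S.card) : (∃ t ⊆ S, IsPent R t) ∨ ∃ t ⊆ S, IsPent B t := by
  classical
  by_contra! hcon
  obtain ⟨hR, hB⟩ := hcon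
  have hBR : ∀ x y, x ≠ y → B.Adj x y ∨ R.Adj x y := fun x y h => (hRB x y h).symm
  have hK : (∃ Q ⊆ S, R.IsNClique 4 Q) ∨ ∃ Q ⊆ S, B.IsNClique 4 Q := by
    obtain ⟨v, hv⟩ : S.Nonempty := Finset.card_pos.1 (by omega)
    have hsub : S.erase v ⊆ S.filter (R.Adj v) ∪ S.filter (B.Adj v) := by
      intro x hx
      have := hRB v x (Finset.ne_of_mem_erase hx).symm
      have := Finset.mem_of_mem_erase hx
      grind
    have h1 := Finset.card_le_card hsub
    have h2 := Finset.card_union_le (S.filter (R.Adj v)) (S.filter (B.Adj v))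
    rw [Finset.card_erase_of_mem hv] at h1
    by_cases h5 : 5 ≤ (S.filter (R.Adj v)).card
    · exact exists_isNClique_four_of_degree hRB hv (Finset.filter_subset _ _)
        (fun x hx => (Finset.mem_filter.1 hx).2) h5 hR hB
    · exact (exists_isNClique_four_of_degree hBR hv (Finset.filter_subset _ _)
        (fun x hx => (Finset.mem_filter.1 hx).2) (by omega) hB hR).symm
  rcases hK with ⟨Q, hQ, hQ4⟩ | ⟨Q, hQ, hQ4⟩
  · rcases exists_isPent_of_isNClique_four hRB hQ hQ4 (by omega) with ⟨t, h, h'⟩ | ⟨t, h, h'⟩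
    exacts [hR t h h', hB t h h']
  · rcases exists_isPent_of_isNClique_four hBR hQ hQ4 (by omega) with ⟨t, h, h'⟩ | ⟨t, h, h'⟩
    exacts [hB t h h', hR t h h']

end SmallRamsey

/-! ### Small blue matching number forces red 5-cycles -/

section Matching

variable {V : Type*} [DecidableEq V] {R B : SimpleGraph V} {S : Finset V}

/-- The structure left by a maximum matching: a set `U` without edges, and an endpoint of each
matching edge with at most one neighbour in `U`. -/
theorem exists_independent_of_maximum_matching {a : ℕ} (h : Packs (IsEdgeSet B) a S)
    (hmax : ¬ Packs (IsEdgeSet B) (a + 1) S) :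
    ∃ U Y : Finset V, U ⊆ S ∧ Y ⊆ S ∧ Disjoint U Y ∧ Y.card = a ∧ U.card + 2 * a = S.card ∧
      Packs (IsEdgeSet B) a (S \ U) ∧ (∀ x ∈ U, ∀ y ∈ U, ¬ B.Adj x y) ∧
      ∀ y ∈ Y, ∀ u ∈ U, ∀ u' ∈ U, u ≠ u' → ¬ (B.Adj y u ∧ B.Adj y u') := by
  induction h with
  | zero S =>
    refine ⟨S, ∅, le_rfl, by simp, by simp, by simp, by simp, .zero _, ?_, by simp⟩
    intro x hx y hy hxy
    exact hmax (.one ⟨x, y, rfl, hxy⟩ (by grind))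
  | @succ a S t ht hS hp ih =>
    obtain ⟨U, Y, hU, hY, hd, hYc, hUc, hp', hind, hone⟩ := ih fun h => hmax (.succ ht hS h)
    -- If both ends p, q of the matching edge had two neighbours in U, they would have distinct ones
    -- x, y; replacing pq by px and qy would enlarge the matching.
    have key : ∃ y ∈ t, ∀ u ∈ U, ∀ u' ∈ U, u ≠ u' → ¬ (B.Adj y u ∧ B.Adj y u') := by
      obtain ⟨p, q, rfl, hpq⟩ := ht
      by_contra! hcon
      obtain ⟨u, hu, u', hu', hne, hpu, hpu'⟩ := hcon p (by simp)
      obtain ⟨w, hw, w', hw', hne', hqw, hqw'⟩ := hcon q (by simp)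
      have aug : ∀ x ∈ U, ∀ y ∈ U, x ≠ y → B.Adj p x → ¬ B.Adj q y := by
        intro x hx y hy hxy hpx hqy
        have hxt := Finset.mem_sdiff.1 (hU hx)
        have hyt := Finset.mem_sdiff.1 (hU hy)
        have hpqne := hpq.ne
        refine hmax (.succ (t := {p, x}) ⟨p, x, rfl, hpx⟩ (by grind) (.succ (t := {q, y})
          ⟨q, y, rfl, hqy⟩ (by grind) (hp'.mono ?_)))
        intro z hz
        simp only [Finset.mem_sdiff, Finset.mem_insert, Finset.mem_singleton, not_or] at hz ⊢
        refine ⟨⟨hz.1.1, hz.1.2.1, ?_⟩, hz.1.2.2, ?_⟩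
        · rintro rfl; exact hz.2 hx
        · rintro rfl; exact hz.2 hy
      by_cases huw : u = w
      · exact aug u hu w' hw' (huw ▸ hne') hpu hqw'
      · exact aug u hu w hw huw hpu hqw
    obtain ⟨y, hyt, hy⟩ := key
    have hyS : y ∉ S \ t := fun h => (Finset.mem_sdiff.1 h).2 hyt
    refine ⟨U, insert y Y, hU.trans Finset.sdiff_subset, ?_, ?_, ?_, ?_, ?_, hind, ?_⟩
    · exact Finset.insert_subset (hS hyt) (hY.trans Finset.sdiff_subset)
    · exact Finset.disjoint_insert_right.2 ⟨fun h => hyS (hU h), hd⟩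
    · rw [Finset.card_insert_of_notMem fun h => hyS (hY h), hYc]
    · rw [Finset.card_sdiff_of_subset hS, ht.card] at hUc
      have := Finset.card_le_card hS
      rw [ht.card] at this
      omega
    · refine .succ ht (fun x hx => Finset.mem_sdiff.2 ⟨hS hx, fun h =>
        (Finset.mem_sdiff.1 (hU h)).2 hx⟩) (hp'.mono fun x hx => ?_)
      grind
    · intro z hz
      rcases Finset.mem_insert.1 hz with rfl | hz
      exacts [hy, hone z hz]

/-- A clique `U` together with at most `m` vertices, each joined to all but at most one vertex
of `U`, contains `m` disjoint `5`-cycles. -/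
theorem packs_isPent_of_isClique (m : ℕ) {U Y : Finset V} (hd : Disjoint U Y)
    (hU : R.IsClique U) (hY : ∀ y ∈ Y, ∀ u ∈ U, ∀ u' ∈ U, u ≠ u' → R.Adj y u ∨ R.Adj y u')
    (hYm : Y.card ≤ m) (hc : 5 * m ≤ U.card + Y.card) : Packs (IsPent R) m (U ∪ Y) := by
  induction m generalizing U Y with
  | zero => exact .zero _
  | succ m ih =>
    rcases Y.eq_empty_or_nonempty with rfl | ⟨y, hy⟩
    · obtain ⟨W, hWU, hW⟩ := Finset.exists_subset_card_eq (s := U) (n := 5) (by simp at hc; omega)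
      obtain ⟨t, htW, ht⟩ := exists_isPent_of_isClique (W := W)
        (hU.subset (Finset.coe_subset.2 hWU)) hW.ge
      have htU := htW.trans hWU
      have := ih (U := U \ t) (Y := ∅) (by simp) (hU.subset (by simp)) (by simp) (by simp)
        (by rw [Finset.card_sdiff_of_subset htU, ht.card]; simp at hc ⊢; omega)
      exact .succ ht (by simpa using htU) (by simpa using this)
    -- Since Y has at most m+1 vertices, U has at least four. The vertex y misses at most one vertex
    -- of W, so it has two neighbours p, q there, and the other two vertices of W complete the
    -- cycle.
    · obtain ⟨W, hWU, hW⟩ := Finset.exists_subset_card_eq (s := U) (n := 4) (by omega)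
      have hyU : y ∉ U := fun h => Finset.disjoint_left.1 hd h hy
      have two : ∀ W' ⊆ W, 2 ≤ W'.card → ∃ u ∈ W', R.Adj y u := by
        intro W' hW' h2
        obtain ⟨u, hu, u', hu', hne⟩ := Finset.one_lt_card.1 h2
        rcases hY y hy u (hWU (hW' hu)) u' (hWU (hW' hu')) hne with h | h
        exacts [⟨u, hu, h⟩, ⟨u', hu', h⟩]
      obtain ⟨p, hp, hyp⟩ := two W le_rfl (by omega)
      obtain ⟨q, hq, hyq⟩ := two (W.erase p) (Finset.erase_subset _ _)
        (by rw [Finset.card_erase_of_mem hp]; omega)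
      have h2 : 1 < ((W.erase p).erase q).card := by
        rw [Finset.card_erase_of_mem hq, Finset.card_erase_of_mem hp]; omega
      obtain ⟨r, hr, s, hs, hrs⟩ := Finset.one_lt_card.1 h2
      simp only [Finset.mem_erase] at hq hr hs
      have hmem := fun {x} (h : x ∈ W) => hWU h
      have ht : IsPent R {y, p, r, s, q} :=
        ⟨y, p, r, s, q, rfl, hyp, hU (hmem hp) (hmem hr.2.2) (Ne.symm hr.2.1),
          hU (hmem hr.2.2) (hmem hs.2.2) hrs, hU (hmem hs.2.2) (hmem hq.2) hs.1, hyq.symm,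
          fun h => hyU (h ▸ hmem hr.2.2), fun h => hyU (h ▸ hmem hs.2.2), Ne.symm hs.2.1,
          Ne.symm hq.1, hr.1⟩
      have hsub : ({y, p, r, s, q} : Finset V) ⊆ insert y W := by
        simp [Finset.insert_subset_iff, hp, hq.2, hr.2.2, hs.2.2]
      have hrec := ih (U := U \ W) (Y := Y.erase y)
        (hd.mono Finset.sdiff_subset (Finset.erase_subset _ _)) (hU.subset (by simp))
        (fun z hz u hu u' hu' => hY z (Finset.mem_of_mem_erase hz) u (Finset.mem_sdiff.1 hu).1 u'
          (Finset.mem_sdiff.1 hu').1)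
        (by rw [Finset.card_erase_of_mem hy]; omega)
        (by rw [Finset.card_sdiff_of_subset hWU, Finset.card_erase_of_mem hy, hW]; omega)
      refine .succ ht (hsub.trans ?_) (hrec.mono fun x hx => ?_)
      · exact Finset.insert_subset (Finset.mem_union_right _ hy)
          (hWU.trans Finset.subset_union_left)
      · have hx' : x ∉ insert y W := by
          have hxd : x ∈ Y → x ∉ W := fun h h' => Finset.disjoint_right.1 hd h (hWU h')
          simp only [Finset.mem_union, Finset.mem_sdiff, Finset.mem_erase] at hx
          rw [Finset.mem_insert, not_or]
          rcases hx with hx | hx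
          · exact ⟨fun h => hyU (h ▸ hx.1), hx.2⟩
          · exact ⟨hx.1, hxd hx.2⟩
        exact Finset.mem_sdiff.2 ⟨Finset.union_subset_union Finset.sdiff_subset
          (Finset.erase_subset _ _) hx, fun h => hx' (hsub h)⟩

/-- If blue has matching number `a ≤ m` on at least `5 * m + a` vertices, then red has `m`
disjoint `5`-cycles in one component. -/
theorem packs_isPent_of_matching (hRB : ∀ x y, x ≠ y → R.Adj x y ∨ B.Adj x y) {m a : ℕ}
    (hm : 1 ≤ m) (ha : a ≤ m) (h : Packs (IsEdgeSet B) a S)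
    (hmax : ¬ Packs (IsEdgeSet B) (a + 1) S) (hS : 5 * m + a ≤ S.card) :
    ∃ T ⊆ S, Packs (IsPent R) m T ∧ ∀ x ∈ T, ∀ y ∈ T, R.Reachable x y := by
  obtain ⟨U, Y, hU, hY, hd, hYc, hUc, -, hind, hone⟩ :=
    exists_independent_of_maximum_matching h hmax
  have hcl : R.IsClique U := fun x hx y hy hxy => (hRB x y hxy).resolve_right (hind x hx y hy)
  have hYU : ∀ y ∈ Y, ∀ u ∈ U, ∀ u' ∈ U, u ≠ u' → R.Adj y u ∨ R.Adj y u' := by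
    intro y hy u hu u' hu' hne
    have hne' : ∀ {z}, z ∈ U → y ≠ z := fun h e => Finset.disjoint_left.1 hd h (e ▸ hy)
    have := hRB y u (hne' hu)
    have := hRB y u' (hne' hu')
    have := hone y hy u hu u' hu' hne
    tauto
  refine ⟨U ∪ Y, Finset.union_subset hU hY,
    packs_isPent_of_isClique m hd hcl hYU (by omega) (by omega), ?_⟩
  obtain ⟨u, hu, u', hu', hne⟩ := Finset.one_lt_card.1 (show 1 < U.card by omega)
  have hUU : ∀ x ∈ U, R.Reachable x u := by
    intro x hx
    by_cases hxu : x = u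
    · rw [hxu]
    · exact (hcl hx hu hxu).reachable
  have hall : ∀ x ∈ U ∪ Y, R.Reachable x u := by
    intro x hx
    rcases Finset.mem_union.1 hx with hx | hx
    · exact hUU x hx
    · rcases hYU x hx u hu u' hu' hne with h | h
      · exact h.reachable
      · exact h.reachable.trans (hUU u' hu')
  exact fun x hx y hy => (hall x hx).trans (hall y hy).symm

/-- The matching number as an attained maximum. -/
theorem exists_maximum_matching (S : Finset V) :
    ∃ a, Packs (IsEdgeSet B) a S ∧ ¬ Packs (IsEdgeSet B) (a + 1) S := by
  by_contra! h
  have hall : ∀ a, Packs (IsEdgeSet B) a S := fun a => by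
    induction a with
    | zero => exact .zero _
    | succ a ih => exact h a ih
  obtain ⟨M, hM, hc, -⟩ := (hall (S.card + 1)).exists_support (p := 2) fun t ht => ht.card
  have := Finset.card_le_card hM
  omega

/-- Every two-colouring of `K₇` contains a red `5`-cycle or a blue path with four vertices. -/
theorem exists_isPent_or_isPathFour (hRB : ∀ x y, x ≠ y → R.Adj x y ∨ B.Adj x y)
    (hS : 7 ≤ S.card) : (∃ t ⊆ S, IsPent R t) ∨ ∃ t ⊆ S, IsPathFour B t := by
  by_contra! hcon
  obtain ⟨hR, hB⟩ := hcon
  obtain ⟨a, ha, hmax⟩ := exists_maximum_matching (B := B) S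
  rcases le_or_gt a 1 with ha1 | ha2
  · obtain ⟨T, hT, hp, -⟩ := packs_isPent_of_matching hRB le_rfl ha1 ha hmax (by omega)
    cases hp with
    | succ ht hs _ => exact hR _ (hs.trans hT) ht
  cases ha.of_le ha2 with
  | @succ _ _ t₁ ht₁ hs₁ h =>
  cases h with
  | @succ _ _ t₂ ht₂ hs₂ _ =>
  obtain ⟨x, y, rfl, hxy⟩ := ht₁
  obtain ⟨z, w, rfl, hzw⟩ := ht₂
  have hzwS : z ∈ S ∧ w ∈ S ∧ z ≠ x ∧ z ≠ y ∧ w ≠ x ∧ w ≠ y := by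
    have h1 := @hs₂ z
    have h2 := @hs₂ w
    grind
  have hxS : x ∈ S := hs₁ (by simp)
  have hyS : y ∈ S := hs₁ (by simp)
  obtain ⟨hzS, hwS, hzx, hzy, hwx, hwy⟩ := hzwS
  have noP : ∀ a ∈ S, ∀ b ∈ S, ∀ c ∈ S, ∀ d ∈ S, B.Adj a b → B.Adj b c → a ≠ c → a ≠ d → b ≠ d →
      ¬ B.Adj c d := by
    intro a ha b hb c hc d hd h1 h2 h3 h4 h5 h6
    obtain ⟨t, ht, ht'⟩ := exists_isPathFour ha hb hc hd h1 h2 h6 h3 h4 h5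
    exact hB t ht ht'
  have red : ∀ {p q}, p ≠ q → ¬ B.Adj p q → R.Adj p q := fun h h' => (hRB _ _ h).resolve_right h'
  have hxyne := hxy.ne
  have hzwne := hzw.ne
  -- A blue edge between {x, y} and {z, w} would give a blue four-vertex path, so x z y w is a red
  -- 4-cycle.
  have hxz : R.Adj x z := red hzx.symm
    (noP y hyS x hxS z hzS w hwS hxy.symm · hzy.symm hwy.symm hwx.symm hzw)
  have hxw : R.Adj x w := red hwx.symm
    (noP y hyS x hxS w hwS z hzS hxy.symm · hwy.symm hzy.symm hzx.symm hzw.symm)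
  have hyz : R.Adj y z := red hzy.symm
    (noP x hxS y hyS z hzS w hwS hxy · hzx.symm hwx.symm hwy.symm hzw)
  have hyw : R.Adj y w := red hwy.symm
    (noP x hxS y hyS w hwS z hzS hxy · hwx.symm hzx.symm hzy.symm hzw.symm)
  have pent : ∀ u ∈ S, u ≠ x → u ≠ y → u ≠ z → u ≠ w → ∀ p ∈ S, ∀ p' ∈ S, ∀ q ∈ S, ∀ q' ∈ S,
      R.Adj p q' → R.Adj q' p' → R.Adj p' q → R.Adj u p → u ≠ q' → u ≠ p' → p ≠ p' → p ≠ q →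
      q' ≠ q → ¬ R.Adj u q := by
    intro u hu _ _ _ _ p hp p' hp' q hq q' hq' h1 h2 h3 h4 h5 h6 h7 h8 h9 h10
    obtain ⟨t, ht, ht'⟩ := exists_isPent hu hp hq' hp' hq h4 h1 h2 h3 h10.symm h5 h6 h7 h8 h9
    exact hR t ht ht'
  -- A vertex u red to two consecutive vertices of the red 4-cycle would be inserted between them to
  -- make a red 5-cycle.
  have tri : ∀ u ∈ S \ {x, y, z, w}, (B.Adj u x ∧ B.Adj u y) ∨ (B.Adj u z ∧ B.Adj u w) := by
    intro u hu
    simp only [Finset.mem_sdiff, Finset.mem_insert, Finset.mem_singleton, not_or] at hu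
    obtain ⟨hu, hux, huy, huz, huw⟩ := hu
    have := pent u hu hux huy huz huw
    have h1 := this x hxS y hyS z hzS w hwS hxw hyw.symm hyz
    have h2 := this x hxS y hyS w hwS z hzS hxz hyz.symm hyw
    have h3 := this y hyS x hxS z hzS w hwS hyw hxw.symm hxz
    have h4 := this y hyS x hxS w hwS z hzS hyz hxz.symm hxw
    by_contra hcon
    rw [not_or, not_and_or, not_and_or] at hcon
    rcases hcon with ⟨hx | hy, hz | hw⟩
    · exact h1 (red hux hx) huw huy hxyne hzx.symm hzwne.symm (red huz hz)
    · exact h2 (red hux hx) huz huy hxyne hwx.symm hzwne (red huw hw)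
    · exact h3 (red huy hy) huw hux hxyne.symm hzy.symm hzwne.symm (red huz hz)
    · exact h4 (red huy hy) huz hux hxyne.symm hwy.symm hzwne (red huw hw)
  have once : ∀ u ∈ S \ {x, y, z, w}, ∀ u' ∈ S \ {x, y, z, w}, u ≠ u' →
      ¬ (B.Adj u x ∧ B.Adj u' y) ∧ ¬ (B.Adj u z ∧ B.Adj u' w) := by
    intro u hu u' hu' hne
    simp only [Finset.mem_sdiff, Finset.mem_insert, Finset.mem_singleton, not_or] at hu hu'
    exact ⟨fun h => noP u hu.1 x hxS y hyS u' hu'.1 h.1 hxy hu.2.2.1 hne (Ne.symm hu'.2.1) h.2.symm,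
      fun h => noP u hu.1 z hzS w hwS u' hu'.1 h.1 hzw hu.2.2.2.2 hne (Ne.symm hu'.2.2.2.1)
        h.2.symm⟩
  have h3 : 2 < (S \ {x, y, z, w}).card := by
    have h1 := Finset.le_card_sdiff {x, y, z, w} S
    have h2 := Finset.card_le_four (a := x) (b := y) (c := z) (d := w)
    omega
  obtain ⟨u, u', u'', hu, hu', hu'', h1, h2, h3⟩ := Finset.two_lt_card_iff.1 h3
  -- Two of the three vertices are blue to both ends of the same blue edge, which gives a blue
  -- four-vertex path with that edge in the middle.
  rcases tri u hu with a | a <;> rcases tri u' hu' with b | b <;> rcases tri u'' hu'' with c | c <;>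
  first
  | exact (once u hu u' hu' h1).1 ⟨a.1, b.2⟩
  | exact (once u hu u' hu' h1).2 ⟨a.1, b.2⟩
  | exact (once u hu u'' hu'' h2).1 ⟨a.1, c.2⟩
  | exact (once u hu u'' hu'' h2).2 ⟨a.1, c.2⟩
  | exact (once u' hu' u'' hu'' h3).1 ⟨b.1, c.2⟩
  | exact (once u' hu' u'' hu'' h3).2 ⟨b.1, c.2⟩

end Matching

/-! ### Blue 5-cycles across a complete blue bipartition -/

theorem reachable_of_cross {V : Type*} {B : SimpleGraph V} {X Z : Finset V} (hX : X.Nonempty) (hZ : Z.Nonempty)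
    (hc : ∀ x ∈ X, ∀ z ∈ Z, B.Adj x z) (hall : ∀ v, v ∈ X ∨ v ∈ Z) (x y : V) :
    B.Reachable x y := by
  obtain ⟨p, hp⟩ := hX
  obtain ⟨q, hq⟩ := hZ
  have h : ∀ v, B.Reachable v p := by
    intro v
    rcases hall v with hv | hv
    · exact (hc v hv q hq).reachable.trans (hc p hp q hq).reachable.symm
    · exact (hc p hp v hv).reachable.symm
  exact (h x).trans (h y).symm

section Cross

variable {V : Type*} [DecidableEq V] {R B : SimpleGraph V}

/-- Each cycle is p q y r z: a matching edge pq and a spare vertex r on one side, y and z on the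
other. It thus costs three vertices on the side of the edge and two on the other. -/
theorem packs_isPent_of_edges_cross {a : ℕ} {M X Y : Finset V} (h : Packs (IsEdgeSet B) a M)
    (hMX : Disjoint M X) (hX : a ≤ X.card) (hd : Disjoint (M ∪ X) Y) (hY : 2 * a ≤ Y.card)
    (hc : ∀ x ∈ M ∪ X, ∀ y ∈ Y, B.Adj x y) : Packs (IsPent B) a (M ∪ X ∪ Y) := by
  have h1 : Packs (fun t => ∃ p q r, t = {p, q, r} ∧ B.Adj p q ∧ p ≠ r ∧ q ≠ r) a (M ∪ X) := by
    refine h.extend (r := 1) hMX (by omega) ?_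
    rintro t x ⟨p, q, rfl, hpq⟩ ht hx hx1
    obtain ⟨r, rfl⟩ := Finset.card_eq_one.1 hx1
    have hr := hx (Finset.mem_singleton_self r)
    have hne : ∀ p ∈ M, p ≠ r := fun p hp e => Finset.disjoint_left.1 hMX hp (e ▸ hr)
    exact ⟨p, q, r, by ext; simp, hpq, hne p (ht (by simp)), hne q (ht (by simp))⟩
  refine h1.extend (r := 2) hd hY ?_
  rintro t x ⟨p, q, r, rfl, hpq, hpr, hqr⟩ ht hx hx2
  obtain ⟨y, z, hyz, rfl⟩ := Finset.card_eq_two.1 hx2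
  have hp := ht (show p ∈ _ by simp)
  have hq := ht (show q ∈ _ by simp)
  have hr := ht (show r ∈ _ by simp)
  have hy := hx (show y ∈ _ by simp)
  have hz := hx (show z ∈ _ by simp)
  exact ⟨p, q, y, r, z, by ext; simp; tauto, hpq, hc q hq y hy, (hc r hr y hy).symm, hc r hr z hz,
    (hc p hp z hz).symm, (hc p hp y hy).ne, hpr, hqr, (hc q hq z hz).ne, hyz⟩

theorem packs_isPent_of_paths_cross {a : ℕ} {M Y : Finset V} (h : Packs (IsPathFour B) a M)
    (hd : Disjoint M Y) (hY : a ≤ Y.card) (hc : ∀ x ∈ M, ∀ y ∈ Y, B.Adj x y) :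
    Packs (IsPent B) a (M ∪ Y) := by
  refine h.extend (r := 1) hd (by omega) ?_
  rintro t x ⟨p, q, r, s, rfl, h1, h2, h3, h4, h5, h6⟩ ht hx hx1
  obtain ⟨y, rfl⟩ := Finset.card_eq_one.1 hx1
  have hy := hx (Finset.mem_singleton_self y)
  have hall : ∀ z ∈ ({p, q, r, s} : Finset V), B.Adj z y := fun z hz => hc z (ht hz) y hy
  have hp := hall p (by simp)
  have hq := hall q (by simp)
  have hr := hall r (by simp)
  have hs := hall s (by simp)
  exact ⟨p, q, r, s, y, by ext; simp, h1, h2, h3, hs, hp.symm, h4, h5, h6, hq.ne, hr.ne⟩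

/-- Matchings on the two sides of a complete bipartite graph give disjoint `5`-cycles. -/
theorem packs_isPent_of_two_matchings {a b : ℕ} {X Z : Finset V} (hX : Packs (IsEdgeSet B) a X)
    (hZ : Packs (IsEdgeSet B) b Z) (hXc : 3 * a + 2 * b ≤ X.card) (hZc : 2 * a + 3 * b ≤ Z.card)
    (hd : Disjoint X Z) (hc : ∀ x ∈ X, ∀ z ∈ Z, B.Adj x z) :
    Packs (IsPent B) (a + b) (X ∪ Z) := by
  obtain ⟨M, hM, hMc, hMp⟩ := hX.exists_support (p := 2) fun t ht => ht.card
  obtain ⟨N, hN, hNc, hNp⟩ := hZ.exists_support (p := 2) fun t ht => ht.card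
  obtain ⟨X₁, hX₁, hX₁c⟩ := Finset.exists_subset_card_eq (s := X \ M) (n := a)
    (by rw [Finset.card_sdiff_of_subset hM]; omega)
  obtain ⟨Z₁, hZ₁, hZ₁c⟩ := Finset.exists_subset_card_eq (s := Z \ N) (n := b)
    (by rw [Finset.card_sdiff_of_subset hN]; omega)
  have hX₁X := hX₁.trans Finset.sdiff_subset
  have hZ₁Z := hZ₁.trans Finset.sdiff_subset
  have hX₂X : (X \ M) \ X₁ ⊆ X := Finset.sdiff_subset.trans Finset.sdiff_subset
  have hZ₂Z : (Z \ N) \ Z₁ ⊆ Z := Finset.sdiff_subset.trans Finset.sdiff_subset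
  have hMX : Disjoint M X₁ := Finset.disjoint_sdiff.mono_right hX₁
  have hNZ : Disjoint N Z₁ := Finset.disjoint_sdiff.mono_right hZ₁
  have h1 := packs_isPent_of_edges_cross (Y := (Z \ N) \ Z₁) hMp hMX hX₁c.ge
    (hd.mono (Finset.union_subset hM hX₁X) hZ₂Z)
    (by rw [Finset.card_sdiff_of_subset hZ₁, Finset.card_sdiff_of_subset hN]; omega)
    (fun x hx y hy => hc x (Finset.union_subset hM hX₁X hx) y (hZ₂Z hy))
  have h2 := packs_isPent_of_edges_cross (Y := (X \ M) \ X₁) hNp hNZ hZ₁c.ge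
    (hd.symm.mono (Finset.union_subset hN hZ₁Z) hX₂X)
    (by rw [Finset.card_sdiff_of_subset hX₁, Finset.card_sdiff_of_subset hM]; omega)
    (fun x hx y hy => (hc y (hX₂X hy) x (Finset.union_subset hN hZ₁Z hx)).symm)
  refine (h1.add h2 ?_).mono ?_
  · have hXZ : ∀ {S T : Finset V}, S ⊆ X → T ⊆ Z → Disjoint S T := fun h h' => hd.mono h h'
    have hXX : Disjoint (M ∪ X₁) ((X \ M) \ X₁) := by
      rw [sdiff_sdiff]; exact Finset.disjoint_sdiff
    have hZZ : Disjoint (N ∪ Z₁) ((Z \ N) \ Z₁) := by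
      rw [sdiff_sdiff]; exact Finset.disjoint_sdiff
    exact Finset.disjoint_union_left.2
      ⟨Finset.disjoint_union_right.2
        ⟨hXZ (Finset.union_subset hM hX₁X) (Finset.union_subset hN hZ₁Z), hXX⟩,
      Finset.disjoint_union_right.2 ⟨hZZ.symm, (hXZ hX₂X hZ₂Z).symm⟩⟩
  · exact Finset.union_subset
      (Finset.union_subset ((Finset.union_subset hM hX₁X).trans Finset.subset_union_left)
        (hZ₂Z.trans Finset.subset_union_right))
      (Finset.union_subset ((Finset.union_subset hN hZ₁Z).trans Finset.subset_union_right)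
        (hX₂X.trans Finset.subset_union_left))

end Cross

/-! ### The upper bound -/

section Upper

variable {V : Type*} [DecidableEq V] {R B : SimpleGraph V}

/-- `G` has `m` disjoint `5`-cycles in one connected component. -/
def HasConnectedPents (G : SimpleGraph V) (m : ℕ) : Prop :=
  ∃ S : Finset V, Packs (IsPent G) m S ∧ ∀ x ∈ S, ∀ y ∈ S, G.Reachable x y

theorem packs_isPent_or_packs_isPent (hRB : ∀ x y, x ≠ y → R.Adj x y ∨ B.Adj x y) {m : ℕ}
    (hm : 1 ≤ m) {S : Finset V} (hS : 10 * m ≤ S.card) :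
    Packs (IsPent R) m S ∨ Packs (IsPent B) m S := by
  obtain ⟨m, rfl⟩ : ∃ k, m = k + 1 := ⟨m - 1, by omega⟩
  exact packs_or_packs (n := 10) (fun t ht => ht.card) (fun t ht => ht.card)
    (fun T _ hT => exists_isPent_or_isPent hRB hT) m m (by omega)

/-- If `Z` is completely blue to `A` and `Z` is not large, then a large `A` yields red `5`-cycles
in `A` or blue `5`-cycles in `A ∪ Z`. -/
theorem packs_isPent_of_small_side (hRB : ∀ x y, x ≠ y → R.Adj x y ∨ B.Adj x y) {m : ℕ}
    (hm : 2 ≤ m) {A Z : Finset V} (hd : Disjoint A Z) (hc : ∀ x ∈ A, ∀ z ∈ Z, B.Adj x z)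
    (hZ : Z.card < 3 * m) (hAZ : 11 * m ≤ A.card + Z.card + 2) :
    Packs (IsPent R) m A ∨ Packs (IsPent B) m (A ∪ Z) := by
  have greedy : ∀ k T, T ⊆ A → 5 * (m - 1) + 4 * k + 7 ≤ T.card →
      Packs (IsPent R) m A ∨ Packs (IsPathFour B) (k + 1) T := by
    intro k T hT h
    obtain ⟨m, rfl⟩ : ∃ k, m = k + 1 := ⟨m - 1, by omega⟩
    exact (packs_or_packs (n := 7) (fun t ht => ht.card) (fun t ht => ht.card)
      (fun T _ hT => exists_isPent_or_isPathFour hRB hT) m k h).imp_left (·.mono hT)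
  -- If |Z| ≤ m-2, then A alone has 10m vertices.
  rcases lt_or_ge (Z.card + 1) m with h1 | h1
  · exact (packs_isPent_or_packs_isPent hRB (by omega) (by omega)).imp_right
      (·.mono Finset.subset_union_left)
  -- Now |Z| = m-1 is considered, where Z completes only m-1 blue paths. A blue 5-cycle inside A
  -- supplies the missing one; if there is none, greedy removal in A finds only red 5-cycles.
  rcases lt_or_ge Z.card m with h2 | h2
  · by_cases hp : ∃ t ⊆ A, IsPent B t
    · obtain ⟨t, htA, ht⟩ := hp
      refine (greedy (m - 2) (A \ t) Finset.sdiff_subset ?_).imp_right fun h => ?_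
      · rw [Finset.card_sdiff_of_subset htA, ht.card]; omega
      · have h3 := packs_isPent_of_paths_cross h (hd.mono_left Finset.sdiff_subset) (by omega)
          (fun x hx => hc x (Finset.mem_sdiff.1 hx).1)
        have h4 : Packs (IsPent B) (m - 2 + 1 + 1) (A ∪ Z) := by
          refine .succ ht (htA.trans Finset.subset_union_left) (h3.mono ?_)
          intro x hx
          have hxd : x ∈ Z → x ∉ A := fun h => Finset.disjoint_right.1 hd h
          have hxt := @htA x
          simp only [Finset.mem_union, Finset.mem_sdiff] at hx ⊢
          tauto
        exact h4.of_le (by omega)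
    · left
      obtain ⟨m, rfl⟩ : ∃ k, m = k + 1 := ⟨m - 1, by omega⟩
      refine (packs_or_packs (S := A) (n := 10) (Q := IsPent B) (fun t ht => ht.card)
        (fun t ht => ht.card) (fun T _ hT => exists_isPent_or_isPent hRB hT) m 0
        (by omega)).resolve_right fun h => ?_
      cases h with
      | succ ht hs _ => exact hp ⟨_, hs, ht⟩
  -- For m ≤ |Z| < 2m each blue path takes one vertex of Z, and |A| ≥ 9m-1 exceeds the 9m-2 needed
  -- by the greedy step. From 2m on, Z can serve m blue matching edges at two vertices each.
  rcases lt_or_ge Z.card (2 * m) with h3 | h3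
  · refine (greedy (m - 1) A le_rfl (by omega)).imp_right fun h => ?_
    exact (packs_isPent_of_paths_cross h hd (by omega) hc).of_le (by omega)
  · obtain ⟨a, ha, hmax⟩ := exists_maximum_matching (B := B) A
    rcases le_or_gt m a with hma | hma
    · right
      exact packs_isPent_of_two_matchings (b := 0) (ha.of_le hma) (.zero Z) (by omega) (by omega)
        hd hc
    · left
      obtain ⟨T, hT, hp, -⟩ := packs_isPent_of_matching hRB (by omega) hma.le ha hmax (by omega)
      exact hp.mono hT

/-- A partition with both sides large and all edges between them blue. -/
theorem hasConnectedPents_of_large_sides (hRB : ∀ x y, x ≠ y → R.Adj x y ∨ B.Adj x y) {m : ℕ}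
    (hm : 2 ≤ m) {A Z : Finset V} (hd : Disjoint A Z) (hall : ∀ v, v ∈ A ∨ v ∈ Z)
    (hc : ∀ x ∈ A, ∀ z ∈ Z, B.Adj x z) (hA : 3 * m ≤ A.card) (hZ : 3 * m ≤ Z.card)
    (hAZ : 11 * m ≤ A.card + Z.card + 2) :
    HasConnectedPents R m ∨ HasConnectedPents B m := by
  obtain ⟨a, ha, hamax⟩ := exists_maximum_matching (B := B) A
  obtain ⟨b, hb, hbmax⟩ := exists_maximum_matching (B := B) Z
  rcases le_or_gt m (a + b) with hab | hab
  · right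
    obtain ⟨a', b', ha', hb', hab'⟩ : ∃ a' b', a' ≤ a ∧ b' ≤ b ∧ a' + b' = m :=
      ⟨min a m, m - min a m, by omega, by omega, by omega⟩
    refine ⟨A ∪ Z, hab' ▸ packs_isPent_of_two_matchings (ha.of_le ha') (hb.of_le hb') (by omega)
      (by omega) hd hc, fun x _ y _ => reachable_of_cross ?_ ?_ hc hall x y⟩
    · exact Finset.card_pos.1 (by omega)
    · exact Finset.card_pos.1 (by omega)
  -- If both sides fell short of 5m plus their blue matching number, the total would be at most
  -- 10m-2+(a+b) ≤ 11m-3.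
  · left
    rcases le_or_gt (5 * m + a) A.card with h | h
    · obtain ⟨T, -, h⟩ := packs_isPent_of_matching hRB (by omega) (by omega) ha hamax h
      exact ⟨T, h⟩
    · obtain ⟨T, -, h⟩ := packs_isPent_of_matching hRB (m := m) (by omega) (by omega) hb hbmax
        (by omega)
      exact ⟨T, h⟩

/-- Let A be a smallest union of red components with at least 3m vertices. If its complement also
has 3m, both sides are large. Otherwise A is red-connected, so red 5-cycles packed in A share a
component. -/
theorem hasConnectedPents_of_not_reachable [Fintype V]
    (hRB : ∀ x y, x ≠ y → R.Adj x y ∨ B.Adj x y) {m : ℕ} (hm : 2 ≤ m)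
    (hV : 11 * m ≤ Fintype.card V + 2) (hR : ¬ ∀ x y, R.Reachable x y) :
    HasConnectedPents R m ∨ HasConnectedPents B m := by
  classical
  let 𝒜 : Finset (Finset V) :=
    Finset.univ.filter fun A => (∀ x ∈ A, ∀ y, R.Adj x y → y ∈ A) ∧ 3 * m ≤ A.card
  obtain ⟨A, hA, hmin⟩ := Finset.exists_min_image 𝒜 Finset.card
    ⟨Finset.univ, by simp [𝒜]; omega⟩
  obtain ⟨hcl, hA3⟩ : (∀ x ∈ A, ∀ y, R.Adj x y → y ∈ A) ∧ 3 * m ≤ A.card := by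
    simpa [𝒜] using hA
  have hmin' : ∀ C : Finset V, (∀ x ∈ C, ∀ y, R.Adj x y → y ∈ C) → 3 * m ≤ C.card →
      A.card ≤ C.card := fun C h h' => hmin C (by simpa [𝒜] using ⟨h, h'⟩)
  have hcard := Finset.card_add_card_compl A
  have hd : Disjoint A Aᶜ := disjoint_compl_right
  have hall : ∀ v, v ∈ A ∨ v ∈ Aᶜ := fun v => by simp [em]
  have hc : ∀ x ∈ A, ∀ z ∈ Aᶜ, B.Adj x z := by
    intro x hx z hz
    rw [Finset.mem_compl] at hz
    exact (hRB x z fun e => hz (e ▸ hx)).resolve_left fun h => hz (hcl x hx z h)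
  rcases le_or_gt (3 * m) Aᶜ.card with hZ | hZ
  · exact hasConnectedPents_of_large_sides hRB hm hd hall hc hA3 hZ (by omega)
  have hconn : ∀ x ∈ A, ∀ y ∈ A, R.Reachable x y := by
    intro x hx y hy
    by_contra hxy
    have h1 : (A.filter (R.Reachable x ·)).card < A.card :=
      Finset.card_lt_card (Finset.filter_ssubset.2 ⟨y, hy, hxy⟩)
    have h2 : (A.filter (¬ R.Reachable x ·)).card < A.card :=
      Finset.card_lt_card (Finset.filter_ssubset.2 ⟨x, hx, by simp⟩)
    have h3 := Finset.card_filter_add_card_filter_not (s := A) (R.Reachable x ·)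
    -- Here |A| ≥ 8m-1 ≥ 6m, so one of the two red-closed pieces of A keeps 3m vertices, against
    -- minimality.
    rcases le_or_gt (3 * m) (A.filter (R.Reachable x ·)).card with h4 | h4
    · refine h1.not_ge (hmin' _ (fun u hu v huv => ?_) h4)
      rw [Finset.mem_filter] at hu ⊢
      exact ⟨hcl u hu.1 v huv, hu.2.trans huv.reachable⟩
    · refine h2.not_ge (hmin' _ (fun u hu v huv => ?_) (by omega))
      rw [Finset.mem_filter] at hu ⊢
      exact ⟨hcl u hu.1 v huv, fun h => hu.2 (h.trans huv.reachable.symm)⟩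
  have hZne : (Aᶜ).Nonempty := by
    rw [Finset.nonempty_iff_ne_empty, Ne, Finset.compl_eq_empty_iff]
    rintro rfl
    exact hR fun x y => hconn x (Finset.mem_univ x) y (Finset.mem_univ y)
  rcases packs_isPent_of_small_side hRB hm hd hc hZ (by omega) with h | h
  · exact .inl ⟨A, h, hconn⟩
  · exact .inr ⟨_, h, fun x _ y _ =>
      reachable_of_cross (Finset.card_pos.1 (by omega)) hZne hc hall x y⟩

/-- Every two-colouring of a complete graph on at least `11 * m - 2` vertices has `m` disjoint
`5`-cycles in one monochromatic component. -/
theorem hasConnectedPents_or_hasConnectedPents [Fintype V]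
    (hRB : ∀ x y, x ≠ y → R.Adj x y ∨ B.Adj x y) {m : ℕ} (hm : 2 ≤ m)
    (hV : 11 * m ≤ Fintype.card V + 2) :
    HasConnectedPents R m ∨ HasConnectedPents B m := by
  by_cases hR : ∀ x y, R.Reachable x y
  · by_cases hB : ∀ x y, B.Reachable x y
    · exact (packs_isPent_or_packs_isPent (S := Finset.univ) hRB (by omega)
        (by rw [Finset.card_univ]; omega)).imp (fun h => ⟨_, h, fun x _ y _ => hR x y⟩)
        (fun h => ⟨_, h, fun x _ y _ => hB x y⟩)
    · exact (hasConnectedPents_of_not_reachable (fun x y h => (hRB x y h).symm) hm hV hB).symm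
  · exact hasConnectedPents_of_not_reachable hRB hm hV hR

end Upper

/-! ### From packings to members of the graph family -/

/-- A packing of `5`-cycles as an injective family of labelled cycles. -/
theorem Packs.exists_cycles {V : Type*} [DecidableEq V] {G : SimpleGraph V} {m : ℕ}
    {S : Finset V} (h : Packs (IsPent G) m S) :
    ∃ f : Fin m → Fin 5 → V, (∀ i j, f i j ∈ S) ∧ (∀ i, Function.Injective (f i)) ∧
      (∀ i i' j j', f i j = f i' j' → i = i') ∧
      ∀ i j j', (SimpleGraph.cycleGraph 5).Adj j j' → G.Adj (f i j) (f i j') := by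
  induction h with
  | zero => exact ⟨fun i => i.elim0, fun i => i.elim0, fun i => i.elim0, fun i => i.elim0,
      fun i => i.elim0⟩
  | @succ m S t ht hS _ ih =>
    obtain ⟨f, hfS, hfi, hfd, hfG⟩ := ih
    obtain ⟨a, b, c, d, e, rfl, h1, h2, h3, h4, h5, h6, h7, h8, h9, h10⟩ := ht
    have hmem : ∀ j, ![a, b, c, d, e] j ∈ ({a, b, c, d, e} : Finset V) := by
      intro j; fin_cases j <;> simp
    refine ⟨Fin.cons ![a, b, c, d, e] f, ?_, ?_, ?_, ?_⟩
    · intro i j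
      refine Fin.cases ?_ (fun i => ?_) i
      · exact hS (hmem j)
      · exact (Finset.mem_sdiff.1 (hfS i j)).1
    · intro i
      refine Fin.cases ?_ (fun i => ?_) i
      · intro j j' h
        simp only [Fin.cons_zero] at h
        have := h1.ne; have := h2.ne; have := h3.ne; have := h4.ne; have := h5.ne
        fin_cases j <;> fin_cases j' <;> simp_all
      · exact hfi i
    · intro i i' j j'
      refine Fin.cases ?_ (fun i => ?_) i <;> refine Fin.cases ?_ (fun i' => ?_) i'
      · simp
      · intro h
        simp only [Fin.cons_zero, Fin.cons_succ] at h
        exact absurd (h ▸ hmem j) (Finset.mem_sdiff.1 (hfS i' j')).2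
      · intro h
        simp only [Fin.cons_zero, Fin.cons_succ] at h
        exact absurd (h ▸ hmem j') (Finset.mem_sdiff.1 (hfS i j)).2
      · intro h
        rw [hfd i i' j j' h]
    · intro i j j' hj
      refine Fin.cases ?_ (fun i => ?_) i
      · simp only [Fin.cons_zero]
        rw [SimpleGraph.cycleGraph_adj] at hj
        revert hj
        fin_cases j <;> fin_cases j' <;> intro hj <;>
          first
          | exact h1 | exact h2 | exact h3 | exact h4 | exact h5
          | exact h1.symm | exact h2.symm | exact h3.symm | exact h4.symm | exact h5.symm
          | exact absurd hj (by decide)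
      · exact hfG i j j' hj

/-- A connected family of `5`-cycles in `G` yields a connected subgraph containing `m C₅`. -/
theorem HasConnectedPents.exists_isContained {V : Type*} [Fintype V] [DecidableEq V]
    {G : SimpleGraph V} {m : ℕ} (hm : 1 ≤ m) (h : HasConnectedPents G m) :
    ∃ H ∈ connectedContaining (copies m (SimpleGraph.cycleGraph 5)), H.2.IsContained G := by
  classical
  obtain ⟨S, hp, hr⟩ := h
  obtain ⟨f, hfS, hfi, hfd, hfG⟩ := hp.exists_cycles
  let v := f ⟨0, hm⟩ 0
  let C := G.connectedComponentMk v
  have hC : ∀ i j, f i j ∈ C.supp := fun i j =>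
    SimpleGraph.ConnectedComponent.sound (hr _ (hfS i j) _ (hfS _ _))
  have hconn : (G.induce C.supp).Connected := C.connected_toSimpleGraph
  -- The whole component serves as the connected graph, relabelled by `Fin` because members of the
  -- family live there.
  let H := (G.induce C.supp).overFin rfl
  let e : G.induce C.supp ≃g H := (G.induce C.supp).overFinIso rfl
  refine ⟨⟨_, H⟩, ⟨e.connected_iff.1 hconn, ?_⟩, ?_⟩
  · let g : copies m (SimpleGraph.cycleGraph 5) →g G.induce C.supp :=
      ⟨fun x => ⟨f x.1 x.2, hC x.1 x.2⟩, by
        rintro ⟨i, j⟩ ⟨i', j'⟩ ⟨h1, h2⟩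
        obtain rfl : i = i' := h1
        exact hfG i j j' h2⟩
    have hg : Function.Injective g := by
      rintro ⟨i, j⟩ ⟨i', j'⟩ h
      have h' : f i j = f i' j' := congrArg Subtype.val h
      obtain rfl := hfd _ _ _ _ h'
      rw [hfi i h']
    exact SimpleGraph.IsContained.trans ⟨⟨g, hg⟩⟩ ⟨e.toCopy⟩
  · exact SimpleGraph.IsContained.trans ⟨e.symm.toCopy⟩
      ⟨(SimpleGraph.Embedding.induce C.supp).toCopy⟩

/-- Every two-colouring of `K_{11m-2}` contains a monochromatic connected graph containing
`m C₅`. -/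
theorem twoColorArrows_eleven_mul_sub_two {m : ℕ} (hm : 2 ≤ m) :
    TwoColorArrows (11 * m - 2) (connectedContaining (copies m (SimpleGraph.cycleGraph 5))) := by
  intro c
  have hRB : ∀ x y, x ≠ y → (c.labelGraph 0).Adj x y ∨ (c.labelGraph 1).Adj x y := by
    intro x y hxy
    simp only [SimpleGraph.TopEdgeLabeling.labelGraph_adj]
    rcases Fin.exists_fin_two.1 ⟨c.get x y hxy, rfl⟩ with h | h
    · exact .inl ⟨hxy, h⟩
    · exact .inr ⟨hxy, h⟩
  rcases hasConnectedPents_or_hasConnectedPents hRB hm (by rw [Fintype.card_fin]; omega) with h | h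
  · exact ⟨0, h.exists_isContained (by omega)⟩
  · exact ⟨1, h.exists_isContained (by omega)⟩

/-! ### The lower bound -/

/-- The graph on `Fin n` formed by two disjoint cliques, on the first `s` and the next `s`
vertices. -/
def twoCliques (n s : ℕ) : SimpleGraph (Fin n) where
  Adj x y := x ≠ y ∧ (x.val / s = y.val / s) ∧ x.val < 2 * s
  symm := ⟨fun x y h => ⟨h.1.symm, h.2.1.symm, by
    have h1 := h.2.1
    have h2 := h.2.2
    have hs : 0 < s := by omega
    rw [← Nat.div_lt_iff_lt_mul hs] at h2 ⊢
    rwa [← h1]⟩⟩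
  loopless := ⟨fun _ h => h.1 rfl⟩

theorem card_filter_div_eq_le (n s k : ℕ) (hs : 0 < s) :
    (Finset.univ.filter fun x : Fin n => x.val / s = k).card ≤ s := by
  have h : (Finset.univ.filter fun x : Fin n => x.val / s = k).card ≤ (Finset.range s).card := by
    refine Finset.card_le_card_of_injOn (fun x => x.val % s) ?_ ?_
    · intro x _
      simpa using Nat.mod_lt _ hs
    · intro x hx y hy hxy
      simp only [Finset.coe_filter, Finset.mem_univ, true_and, Set.mem_ofPred_eq] at hx hy hxy
      apply Fin.ext
      rw [← Nat.div_add_mod x.val s, ← Nat.div_add_mod y.val s, hx, hy, hxy]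
  simpa using h

/-- An odd cycle has no proper 2-colouring. -/
theorem exists_cycleGraph_five_adj_eq (g : Fin 5 → Prop) :
    ∃ i j, (SimpleGraph.cycleGraph 5).Adj i j ∧ (g i ↔ g j) := by
  by_contra! h
  have h1 := h 0 1 (SimpleGraph.cycleGraph_adj.2 (by decide))
  have h2 := h 1 2 (SimpleGraph.cycleGraph_adj.2 (by decide))
  have h3 := h 2 3 (SimpleGraph.cycleGraph_adj.2 (by decide))
  have h4 := h 3 4 (SimpleGraph.cycleGraph_adj.2 (by decide))
  have h5 := h 4 0 (SimpleGraph.cycleGraph_adj.2 (by decide))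
  tauto

/-- Colouring two disjoint cliques of order `5 * m - 1` red, and all other edges blue, avoids
monochromatic connected graphs containing `m C₅` on fewer than `11 * m - 2` vertices. -/
theorem not_twoColorArrows {m n : ℕ} (hm : 1 ≤ m) (hn : n + 2 < 11 * m) :
    ¬ TwoColorArrows n (connectedContaining (copies m (SimpleGraph.cycleGraph 5))) := by
  classical
  intro h
  set s := 5 * m - 1 with hs
  have hs0 : 0 < s := by omega
  obtain ⟨i, ⟨k, H⟩, ⟨hconn, ⟨f⟩⟩, ⟨g⟩⟩ := h (twoCliques n s).toTopEdgeLabeling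
  simp only at hconn f g
  have hfg : Function.Injective fun x => g (f x) := g.injective.comp f.injective
  fin_cases i
  · have hadj : ∀ x y, H.Adj x y → ¬ (twoCliques n s).Adj (g x) (g y) := by
      intro x y hxy
      exact ((SimpleGraph.toTopEdgeLabeling_labelGraph_compl (twoCliques n s)).le
        (g.toHom.map_adj hxy)).2
    -- Colour 0 is the complement of the cliques. A 5-cycle avoiding the leftover vertices would
    -- have an edge inside one clique, so each of the m disjoint cycles claims its own leftover
    -- vertex, and fewer than m exist.
    have hbig : ∀ i : Fin m, ∃ j : Fin 5, 2 * s ≤ (g (f (i, j))).val := by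
      intro i
      by_contra! hcon
      obtain ⟨j, j', hjj, hiff⟩ := exists_cycleGraph_five_adj_eq
        fun j => (g (f (i, j))).val / s = 0
      have hdiv : ∀ j, (g (f (i, j))).val / s < 2 := fun j =>
        (Nat.div_lt_iff_lt_mul hs0).2 (hcon j)
      have h1 := hdiv j
      have h2 := hdiv j'
      refine hadj _ _ (f.toHom.map_adj (show (copies m _).Adj (i, j) (i, j') from ⟨rfl, hjj⟩))
        ⟨fun e => hjj.ne ?_, ?_, hcon j⟩
      · exact (Prod.ext_iff.1 (hfg e)).2
      · have key : ∀ u v : ℕ, u < 2 → v < 2 → (u = 0 ↔ v = 0) → u = v := by omega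
        exact key _ _ h1 h2 hiff
    choose j hj using hbig
    have hle : (Finset.univ : Finset (Fin m)).card ≤ (Finset.Ico (2 * s) n).card := by
      refine Finset.card_le_card_of_injOn (fun i => (g (f (i, j i))).val) ?_ ?_
      · intro i _
        exact Finset.mem_coe.2 (Finset.mem_Ico.2 ⟨hj i, (g (f (i, j i))).isLt⟩)
      · intro i _ i' _ e
        exact (Prod.ext_iff.1 (hfg (Fin.ext e))).1
    rw [Finset.card_univ, Fintype.card_fin, Nat.card_Ico] at hle
    omega
  · have hadj : ∀ x y, H.Adj x y → (twoCliques n s).Adj (g x) (g y) := by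
      intro x y hxy
      exact (SimpleGraph.toTopEdgeLabeling_labelGraph (twoCliques n s)).le
        (g.toHom.map_adj hxy)
    -- In the clique colour the quotient by s is constant along edges, so the connected graph lies
    -- in one clique, where 5m vertices do not fit.
    have hdiv : ∀ x y, (g x).val / s = (g y).val / s := by
      intro x y
      obtain ⟨w⟩ := hconn.preconnected x y
      induction w with
      | nil => rfl
      | cons h _ ih => exact (hadj _ _ h).2.1.trans ih
    have hle : (Finset.univ : Finset (Fin m × Fin 5)).card ≤ _ :=
      (Finset.card_le_card_of_injOn (fun x => g (f x))
        (t := Finset.univ.filter fun x : Fin n => x.val / s = (g (f (⟨0, hm⟩, 0))).val / s)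
        (fun x _ => by simpa using hdiv _ _) hfg.injOn).trans (card_filter_div_eq_le n s _ hs0)
    rw [Finset.card_univ, Fintype.card_prod, Fintype.card_fin, Fintype.card_fin] at hle
    omega

theorem mainTheorem5 (m : ℕ) (hm : 2 ≤ m) :
    IsTwoColorRamseyNumber
      (connectedContaining (copies m (SimpleGraph.cycleGraph 5))) (11 * m - 2) := by
  refine ⟨twoColorArrows_eleven_mul_sub_two hm, fun n hn => ?_⟩
  by_contra hlt
  exact not_twoColorArrows (by omega) (by omega) hn
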